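/- **Setting.** Fix a type of algebras with finitary operation symbols, and a variety $\mathbf V$ of (nonempty) algebras of this type. Assume $\mathbf V$ is a *variety with $\vec 0$ and $\vec 1$*: there are $0$-ary terms $0_1,\dots,0_n,1_1,\dots,1_n$ such that, with $\vec 0=(0_1,\dots,0_n)$ and $\vec 1=(1_1,\dots,1_n)$, $\mathbf V\models \vec 0\approx\vec 1\rightarrow x\approx y$. For $\vec a\in A^n$ and $\vec b\in B^n$ write $[\vec a,\vec b]=((a_1,b_1),\dots,(a_n,b_n))\in(A\times B)^n$. - Congruences $\theta,\delta$ of $A$ are *complementary factor congruences* if $\theta\cap\delta=\Delta^A$ and $\theta\circ\delta=\nabla^A$; each of them is then called a *factor congruence*. $\mathbf V$ has *Boolean factor congruences* (BFC) if for every $A\in\mathbf V$ the set of factor congruences of $A$ is a Boolean sublattice of the congruence lattice of $A$. - $\mathbf V$ has *RexDFC* (right existentially definable factor congruences) if it has BFC and there is an existential first-order formula $\lambda(\vec z,x,y)$ such that for all $A,B\in\mathbf V$, $a,b\in A$ and $c,d\in B$: $A\times B\models\lambda([\vec 0,\vec 1],(a,c),(b,d))$ if and only if $c=d$. - $\mathbf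 V$ has *LexDFC* (left existentially definable factor congruences) if it has BFC and there is an existential first-order formula $\rho(\vec z,x,y)$ such that for all $A,B\in\mathbf V$, $a,b\in A$ and $c,d\in B$: $A\times B\models\rho([\vec 0,\vec 1],(a,c),(b,d))$ if and only if $a=b$. - $\mathbf V$ has *TexDFC* (twice existentially definable factor congruences) if it has both RexDFC and LexDFC. - $\vec e\in A^n$ is a *central element* of $A$ if there is an isomorphism $\tau:A\to A_1\times A_2$ with $\tau(\vec e)=[\vec 0,\vec 1]$; $\vec e,\vec f\in A^n$ are *complementary central elements* of $A$ if there is an isomorphism $\tau:A\to A_1\times A_2$ with $\tau(\vec e)=[\vec 0,\vec 1]$ and $\tau(\vec f)=[\vec 1,\vec 0]$. - $\mathbf V$ is *stable by complements* if every homomorphism $f:A\to B$ with $A,B\in\mathbf V$ maps central elements of $A$ to central elements of $B$, and pairs of complementary central elements of $A$ to pairs of complementary central elements of $B$. **Corollary.** If $\mathbf V$ has RexDFC and is stable by complements, then $\mathbf V$ has LexDFC, and hence has TexDFC. -/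

import Mathlib

namespace UnivAlg

open FirstOrder FirstOrder.Language FirstOrder.Language.Structure

/-- The direct product of two structures, with coordinatewise operations. -/
instance prodStructure.{u, v, w, w'} (L : FirstOrder.Language.{u, v}) (A : Type w) (B : Type w')
    [L.Structure A] [L.Structure B] : L.Structure (A × B) where
  funMap f x := (funMap f fun i => (x i).1, funMap f fun i => (x i).2)
  RelMap r x := (RelMap r fun i => (x i).1) ∧ (RelMap r fun i => (x i).2)

/-! ### Congruences -/

/-- A congruence of an `L`-algebra: an equivalence relation compatible with all operations. -/
@[ext]
structure Congruence.{u, v, w} (L : FirstOrder.Language.{u, v}) (A : Type w) [L.Structure A]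
    extends Setoid A where
  funMap_rel : ∀ {k : ℕ} (f : L.Functions k) (x y : Fin k → A),
    (∀ i, r (x i) (y i)) → r (funMap f x) (funMap f y)

namespace Congruence

universe u v w

variable {L : FirstOrder.Language.{u, v}} {A : Type w} [L.Structure A]

theorem toSetoid_injective :
    Function.Injective (Congruence.toSetoid : Congruence L A → Setoid A) := by
  rintro ⟨s, hs⟩ ⟨t, ht⟩ h
  cases h
  rfl

/-- Congruences are ordered by inclusion. -/
instance : PartialOrder (Congruence L A) :=
  PartialOrder.lift Congruence.toSetoid toSetoid_injective

/-- The intersection of a set of congruences. -/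
instance : InfSet (Congruence L A) where
  sInf S :=
    { r := fun a b => ∀ θ ∈ S, θ.r a b
      iseqv :=
        ⟨fun a θ _ => θ.iseqv.refl a, fun h θ hθ => θ.iseqv.symm (h θ hθ),
          fun h h' θ hθ => θ.iseqv.trans (h θ hθ) (h' θ hθ)⟩
      funMap_rel := fun f x y h θ hθ => θ.funMap_rel f x y fun i => h i θ hθ }

/-- The congruence lattice `Con(A)`: meets are intersections, and the join of a set of
congruences is the least congruence containing all of them. -/
instance : CompleteLattice (Congruence L A) :=
  completeLatticeOfInf (Congruence L A) fun _ =>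
    ⟨fun _ hθ _ _ h => h _ hθ, fun _ hδ _ _ h θ hθ => hδ hθ h⟩

/-- `θ` and `δ` are complementary factor congruences:
`θ ∩ δ` is the identity and `θ ∘ δ` is the universal relation. -/
def IsFactorPair (θ δ : Congruence L A) : Prop :=
  (∀ a b, θ.r a b → δ.r a b → a = b) ∧ (∀ a b, ∃ c, θ.r a c ∧ δ.r c b)

/-- `θ` is a factor congruence. -/
def IsFactor (θ : Congruence L A) : Prop := ∃ δ, IsFactorPair θ δ

end Congruence

/-- `S` is a Boolean sublattice of the bounded lattice `α`: a sublattice containing `⊥` and `⊤`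
that is distributive and complemented. -/
structure IsBooleanSublattice.{w} {α : Type w} [Lattice α] [BoundedOrder α] (S : Set α) :
    Prop where
  isSublattice : IsSublattice S
  bot_mem : ⊥ ∈ S
  top_mem : ⊤ ∈ S
  distrib : ∀ x ∈ S, ∀ y ∈ S, ∀ z ∈ S, x ⊓ (y ⊔ z) = (x ⊓ y) ⊔ (x ⊓ z)
  complemented : ∀ x ∈ S, ∃ y ∈ S, IsCompl x y

/-! ### Varieties

A variety is given by a set `E` of identities `s ≈ t`; its members are the nonempty algebras
satisfying all identities in `E`. -/

section

universe u v w

/-- `A` is a member of the variety axiomatized by the set of identities `E`. -/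
structure InVariety {L : FirstOrder.Language.{u, v}} (E : Set (L.Term ℕ × L.Term ℕ)) (A : Type w)
    [L.Structure A] : Prop where
  nonempty : Nonempty A
  sat : ∀ p ∈ E, ∀ x : ℕ → A, p.1.realize x = p.2.realize x

/-- The value in `A` of a tuple of `0`-ary terms. -/
def val {L : FirstOrder.Language.{u, v}} {n : ℕ} (c : Fin n → L.Term Empty) (A : Type w)
    [L.Structure A] : Fin n → A :=
  fun i => (c i).realize Empty.elim

/-- For tuples `a` in `A` and `b` in `B`, the tuple `[a, b]` in `A × B`. -/
def pair {A B : Type w} {n : ℕ} (a : Fin n → A) (b : Fin n → B) : Fin n → A × B :=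
  fun i => (a i, b i)

end

/-- The variety axiomatized by `E` is a variety with `0` and `1`: it satisfies
`0 ≈ 1 → x ≈ y`, where `0` and `1` are the given tuples of `0`-ary terms. -/
def IsWithZeroOne.{u, v, w} {L : FirstOrder.Language.{u, v}} (E : Set (L.Term ℕ × L.Term ℕ)) {n : ℕ}
    (zero one : Fin n → L.Term Empty) : Prop :=
  ∀ (A : Type w) [L.Structure A], InVariety E A →
    val zero A = val one A → ∀ x y : A, x = y

/-- Boolean factor congruences: in each member of the variety the factor congruences form a
Boolean sublattice of the congruence lattice. -/
def HasBFC.{u, v, w} {L : FirstOrder.Language.{u, v}} (E : Set (L.Term ℕ × L.Term ℕ)) : Prop :=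
  ∀ (A : Type w) [L.Structure A], InVariety E A →
    IsBooleanSublattice {θ : Congruence L A | θ.IsFactor}

/-- The formula `ρ(z, x, y)` satisfies (L): in all products `A × B` of members of the variety,
`ρ([0, 1], (a, c), (b, d))` holds iff `a = b`. -/
def DefinesLeft.{u, v, w} {L : FirstOrder.Language.{u, v}} (E : Set (L.Term ℕ × L.Term ℕ)) {n : ℕ}
    (zero one : Fin n → L.Term Empty) (ρ : L.Formula (Fin n ⊕ Fin 2)) : Prop :=
  ∀ (A B : Type w) [L.Structure A] [L.Structure B], InVariety E A → InVariety E B →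
    ∀ (a b : A) (c d : B),
      ρ.Realize (Sum.elim (pair (val zero A) (val one B)) ![(a, c), (b, d)]) ↔ a = b

/-- The formula `ρ(z, x, y)` satisfies (R): in all products `A × B` of members of the variety,
`ρ([0, 1], (a, c), (b, d))` holds iff `c = d`. -/
def DefinesRight.{u, v, w} {L : FirstOrder.Language.{u, v}} (E : Set (L.Term ℕ × L.Term ℕ)) {n : ℕ}
    (zero one : Fin n → L.Term Empty) (ρ : L.Formula (Fin n ⊕ Fin 2)) : Prop :=
  ∀ (A B : Type w) [L.Structure A] [L.Structure B], InVariety E A → InVariety E B →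
    ∀ (a b : A) (c d : B),
      ρ.Realize (Sum.elim (pair (val zero A) (val one B)) ![(a, c), (b, d)]) ↔ c = d

/-- Left existentially definable factor congruences. -/
def HasLexDFC.{u, v, w} {L : FirstOrder.Language.{u, v}} (E : Set (L.Term ℕ × L.Term ℕ)) {n : ℕ}
    (zero one : Fin n → L.Term Empty) : Prop :=
  HasBFC.{u, v, w} E ∧
    ∃ ρ : L.Formula (Fin n ⊕ Fin 2),
      BoundedFormula.IsExistential ρ ∧ DefinesLeft.{u, v, w} E zero one ρ

/-- Right existentially definable factor congruences. -/
def HasRexDFC.{u, v, w} {L : FirstOrder.Language.{u, v}} (E : Set (L.Term ℕ × L.Term ℕ)) {n : ℕ}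
    (zero one : Fin n → L.Term Empty) : Prop :=
  HasBFC.{u, v, w} E ∧
    ∃ ρ : L.Formula (Fin n ⊕ Fin 2),
      BoundedFormula.IsExistential ρ ∧ DefinesRight.{u, v, w} E zero one ρ

/-- Twice existentially definable factor congruences. -/
def HasTexDFC.{u, v, w} {L : FirstOrder.Language.{u, v}} (E : Set (L.Term ℕ × L.Term ℕ)) {n : ℕ}
    (zero one : Fin n → L.Term Empty) : Prop :=
  HasRexDFC.{u, v, w} E zero one ∧ HasLexDFC.{u, v, w} E zero one

/-- `e` is a central element of `A`: some isomorphism `A ≃ A₁ × A₂` maps `e` to `[0, 1]`. -/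
def IsCentral.{u, v, w} {L : FirstOrder.Language.{u, v}} {n : ℕ} (zero one : Fin n → L.Term Empty)
    {A : Type w} [L.Structure A] (e : Fin n → A) : Prop :=
  ∃ (A₁ A₂ : Type w) (_ : L.Structure A₁) (_ : L.Structure A₂) (τ : A ≃[L] A₁ × A₂),
    τ ∘ e = pair (val zero A₁) (val one A₂)

/-- `e` and `f` are complementary central elements of `A`: some isomorphism `A ≃ A₁ × A₂` maps
`e` to `[0, 1]` and `f` to `[1, 0]`. -/
def IsComplCentral.{u, v, w} {L : FirstOrder.Language.{u, v}} {n : ℕ} (zero one : Fin n → L.Term Empty)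
    {A : Type w} [L.Structure A] (e f : Fin n → A) : Prop :=
  ∃ (A₁ A₂ : Type w) (_ : L.Structure A₁) (_ : L.Structure A₂) (τ : A ≃[L] A₁ × A₂),
    τ ∘ e = pair (val zero A₁) (val one A₂) ∧ τ ∘ f = pair (val one A₁) (val zero A₂)

/-- The variety is stable by complements: every homomorphism between its members preserves
central elements and pairs of complementary central elements. -/
def IsStableByComplements.{u, v, w} {L : FirstOrder.Language.{u, v}} (E : Set (L.Term ℕ × L.Term ℕ)) {n : ℕ}
    (zero one : Fin n → L.Term Empty) : Prop :=
  ∀ (A B : Type w) [L.Structure A] [L.Structure B], InVariety E A → InVariety E B →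
    ∀ g : A →[L] B,
      (∀ e : Fin n → A, IsCentral zero one e → IsCentral zero one (g ∘ e)) ∧
      (∀ e f : Fin n → A, IsComplCentral zero one e f →
        IsComplCentral zero one (g ∘ e) (g ∘ f))

end UnivAlg

universe u v w

namespace UnivAlg

open FirstOrder FirstOrder.Language FirstOrder.Language.Structure

universe w'

variable {L : FirstOrder.Language.{u, v}}

/-! ### Homomorphisms -/

section Hom

variable {A B C D : Type*} [L.Structure A] [L.Structure B] [L.Structure C] [L.Structure D]

/-! Let `F` be free on x, y and let g be any homomorphism from F × F into a member C of the variety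
with g([0, 1]) = 0. By stability, 0 and g([1, 0]) are complementary central in C, which forces g([1,
0]) = 1 (`IsStableByComplements.apply_pair_eq_one`). Existential formulas persist along embeddings,
so right definability makes g independent of the second coordinate
(`DefinesRight.apply_eq_of_apply_pair_eq_one`); in particular g(x, x) = g(x, y). Thus (x, x) and (x,
y) are identified as soon as [0, 1] is set equal to 0. By compactness this depends on finitely many
operation instances in F × F (`exists_finite_respects`), and the solvability of those equations is
the required formula ρ. It holds at pairs (a, c), (a, d), which are homomorphic images of the
generic pair; conversely it yields a = b on applying the first projection, which sends [0, 1] to 0.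
-/

/-- In an algebraic language a map commuting with the operations is a homomorphism. -/
def homOfFun [L.IsAlgebraic] (g : A → B)
    (hg : ∀ {k : ℕ} (f : L.Functions k) (x : Fin k → A), g (funMap f x) = funMap f (g ∘ x)) :
    A →[L] B where
  toFun := g
  map_fun' := hg
  map_rel' r := isEmptyElim r

variable (L A B) in
/-- The first projection. -/
def fstHom : A × B →[L] A where
  toFun := Prod.fst
  map_rel' _ _ h := h.1

variable (L A B) in
/-- The second projection. -/
def sndHom : A × B →[L] B where
  toFun := Prod.snd
  map_rel' _ _ h := h.2

/-- The homomorphism into a product with given coordinates. -/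
def prodHom (g : A →[L] B) (h : A →[L] C) : A →[L] B × C where
  toFun a := (g a, h a)
  map_fun' f x := Prod.ext (g.map_fun f x) (h.map_fun f x)
  map_rel' r x hr := ⟨g.map_rel r x hr, h.map_rel r x hr⟩

theorem map_val {n : ℕ} (c : Fin n → L.Term Empty) (g : A →[L] B) : g ∘ val c A = val c B := by
  funext i
  exact (HomClass.realize_term g).symm.trans
    (congrArg (fun x => (c i).realize x) (Subsingleton.elim _ _))

theorem InVariety.of_surjective {E : Set (L.Term ℕ × L.Term ℕ)} (g : A →[L] B)
    (hg : Function.Surjective g) (hA : InVariety E A) : InVariety E B where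
  nonempty := hA.nonempty.map g
  sat p hp x := by
    obtain ⟨y, rfl⟩ : ∃ y : ℕ → A, g ∘ y = x :=
      ⟨fun i => (hg (x i)).choose, funext fun i => (hg (x i)).choose_spec⟩
    rw [HomClass.realize_term g, HomClass.realize_term g, hA.sat p hp y]

theorem InVariety.prod {E : Set (L.Term ℕ × L.Term ℕ)} (hA : InVariety E A)
    (hB : InVariety E B) : InVariety E (A × B) where
  nonempty := by
    obtain ⟨a⟩ := hA.nonempty
    obtain ⟨b⟩ := hB.nonempty
    exact ⟨(a, b)⟩
  sat p hp x := by
    refine Prod.ext ?_ ?_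
    · have := hA.sat p hp (fstHom L A B ∘ x)
      rwa [HomClass.realize_term, HomClass.realize_term] at this
    · have := hB.sat p hp (sndHom L A B ∘ x)
      rwa [HomClass.realize_term, HomClass.realize_term] at this

end Hom

/-! ### Quotients and free algebras -/

section Quotient

variable {A : Type w} [L.Structure A]

/-- The quotient of an algebra by a congruence. -/
def Congruence.Quot (θ : Congruence L A) : Type w := Quotient θ.toSetoid

/-- Operations act on chosen representatives; compatibility of the congruence makes the choice
immaterial. In an algebraic language the relation clause is vacuous. -/
noncomputable instance (θ : Congruence L A) : L.Structure θ.Quot where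
  funMap f x := Quotient.mk θ.toSetoid (funMap f fun i => Quotient.out (x i))
  RelMap r x := RelMap r fun i => Quotient.out (x i)

/-- The quotient homomorphism. -/
noncomputable def Congruence.mkHom [L.IsAlgebraic] (θ : Congruence L A) : A →[L] θ.Quot :=
  homOfFun (fun a => Quotient.mk θ.toSetoid a) fun f x =>
    Quotient.sound (θ.funMap_rel f _ _ fun i => θ.iseqv.symm (Quotient.mk_out (x i)))

theorem Congruence.mkHom_surjective [L.IsAlgebraic] (θ : Congruence L A) :
    Function.Surjective θ.mkHom :=
  Quotient.exists_rep

theorem Congruence.mkHom_eq_iff [L.IsAlgebraic] (θ : Congruence L A) {a b : A} :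
    θ.mkHom a = θ.mkHom b ↔ θ.r a b :=
  Quotient.eq (r := θ.toSetoid)

/-- The term algebra; in an algebraic language the choice of relations is immaterial. -/
instance termStructure (X : Type w) : L.Structure (L.Term X) where
  funMap := Term.func
  RelMap _ _ := True

/-- The homomorphism from the term algebra extending an assignment. -/
def realizeHom [L.IsAlgebraic] {X : Type*} (x : X → A) : L.Term X →[L] A :=
  homOfFun (fun t => t.realize x) fun _ _ => rfl

/-- The congruence of the term algebra given by the identities true in the variety. -/
def identityCongruence (E : Set (L.Term ℕ × L.Term ℕ)) (X : Type w') :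
    Congruence L (L.Term X) where
  r s t := ∀ (A : Type max u w) [L.Structure A], InVariety E A →
    ∀ x : X → A, s.realize x = t.realize x
  iseqv := ⟨fun _ _ _ _ _ => rfl, fun h A _ hA x => (h A hA x).symm,
    fun h h' A _ hA x => (h A hA x).trans (h' A hA x)⟩
  funMap_rel f _ _ h A _ hA x := congrArg (funMap f) (funext fun i => h i A hA x)

/-- Free algebras exist in every variety. -/
theorem exists_free [L.IsAlgebraic] (E : Set (L.Term ℕ × L.Term ℕ)) (X : Type) [Nonempty X] :
    ∃ (F : Type max u w) (_ : L.Structure F) (ι : X → F), InVariety E F ∧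
      ∀ (A : Type max u w) [L.Structure A], InVariety E A →
        ∀ x : X → A, ∃ g : F →[L] A, ∀ i, g (ι i) = x i := by
  let θ := identityCongruence.{u, v, w, w} E (ULift.{w} X)
  refine ⟨θ.Quot, inferInstance, fun i => θ.mkHom (Term.var ⟨i⟩), ⟨?_, ?_⟩, ?_⟩
  · exact ⟨θ.mkHom (Term.var ⟨Classical.arbitrary X⟩)⟩
  · intro p hp x
    obtain ⟨y, rfl⟩ : ∃ y : ℕ → L.Term (ULift.{w} X), θ.mkHom ∘ y = x :=
      ⟨fun i => (θ.mkHom_surjective (x i)).choose,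
        funext fun i => (θ.mkHom_surjective (x i)).choose_spec⟩
    rw [HomClass.realize_term, HomClass.realize_term, θ.mkHom_eq_iff]
    -- Each substitution instance of an identity of `E` holds in every member of the variety.
    intro A _ hA z
    have := hA.sat p hp (realizeHom z ∘ y)
    rwa [HomClass.realize_term, HomClass.realize_term] at this
  · intro A _ hA x
    have hout (t : L.Term (ULift.{w} X)) :
        (Quotient.out (θ.mkHom t)).realize (fun i => x i.down) =
          t.realize fun i => x i.down :=
      Quotient.mk_out (s := θ.toSetoid) t A hA _
    refine ⟨homOfFun (fun q : θ.Quot => (Quotient.out q).realize fun i : ULift.{w} X => x i.down)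
      fun f q => ?_, fun i => hout (Term.var ⟨i⟩)⟩
    exact hout (Term.func f fun i => Quotient.out (q i))

end Quotient

/-! ### Finitely many equations -/

section Compactness

variable {P : Type w} [L.Structure P]

/-- The map `g` commutes with the finitely many instances of operations listed in `Δ`. -/
def Respects (Δ : Set (Σ k, L.Functions k × (Fin k → P))) {C : Type*} [L.Structure C]
    (g : P → C) : Prop :=
  ∀ o ∈ Δ, g (funMap o.2.1 o.2.2) = funMap o.2.1 (g ∘ o.2.2)

/-- Evaluating a term uses one operation instance per compound subterm. -/
theorem exists_finite_respects_realize {X : Type*} (t : L.Term X) (x : X → P) :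
    ∃ Δ : Set (Σ k, L.Functions k × (Fin k → P)), Δ.Finite ∧
      ∀ (C : Type w) [L.Structure C] (g : P → C), Respects Δ g →
        g (t.realize x) = t.realize (g ∘ x) := by
  induction t with
  | var i => exact ⟨∅, Set.finite_empty, fun _ _ _ _ => rfl⟩
  | @func k f ts ih =>
    choose Δ hfin hΔ using ih
    refine ⟨{⟨k, f, fun i => (ts i).realize x⟩} ∪ ⋃ i, Δ i,
      (Set.finite_singleton _).union (Set.finite_iUnion hfin), fun C _ g hg => ?_⟩
    refine (hg _ (Or.inl rfl)).trans (congrArg (funMap f) (funext fun i => ?_))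
    exact hΔ i C g fun o ho => hg o (Or.inr (Set.mem_iUnion.2 ⟨i, ho⟩))

/-- The congruence of `P` consisting of the pairs identified by all maps into members of the
variety that send `e` to `0` and commute with finitely many instances of operations. -/
def finitaryCongruence (E : Set (L.Term ℕ × L.Term ℕ)) {n : ℕ} (zero : Fin n → L.Term Empty)
    (e : Fin n → P) : Congruence L P where
  r a b := ∃ Δ : Set (Σ k, L.Functions k × (Fin k → P)), Δ.Finite ∧
    ∀ (C : Type w) [L.Structure C], InVariety E C → ∀ g : P → C, Respects Δ g →
      g ∘ e = val zero C → g a = g b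
  iseqv := by
    refine ⟨fun a => ⟨∅, Set.finite_empty, fun _ _ _ _ _ _ => rfl⟩, ?_, ?_⟩
    · rintro a b ⟨Δ, hfin, h⟩
      exact ⟨Δ, hfin, fun C _ hC g hg he => (h C hC g hg he).symm⟩
    · rintro a b c ⟨Δ, hfin, h⟩ ⟨Δ', hfin', h'⟩
      exact ⟨Δ ∪ Δ', hfin.union hfin', fun C _ hC g hg he =>
        (h C hC g (fun o ho => hg o (Or.inl ho)) he).trans
          (h' C hC g (fun o ho => hg o (Or.inr ho)) he)⟩
  funMap_rel := by
    intro k f a b h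
    choose Δ hfin hΔ using h
    refine ⟨{⟨k, f, a⟩} ∪ {⟨k, f, b⟩} ∪ ⋃ i, Δ i,
      ((Set.finite_singleton _).union (Set.finite_singleton _)).union (Set.finite_iUnion hfin),
      fun C _ hC g hg he => ?_⟩
    refine (hg _ (Or.inl (Or.inl rfl))).trans (Eq.trans ?_ (hg _ (Or.inl (Or.inr rfl))).symm)
    exact congrArg (funMap f) (funext fun i =>
      hΔ i C hC g (fun o ho => hg o (Or.inr (Set.mem_iUnion.2 ⟨i, ho⟩))) he)

/-- Compactness through a single quotient: `P` modulo `finitaryCongruence` is itself in the variety,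
and its quotient map sends `e` to 0, so `h` applies to that map. The resulting equality of classes
is exactly the existence of a finite `Δ`. -/
theorem exists_finite_respects [L.IsAlgebraic] {E : Set (L.Term ℕ × L.Term ℕ)} {n : ℕ}
    {zero : Fin n → L.Term Empty} {e : Fin n → P} {a b : P} (hP : InVariety E P)
    (h : ∀ (C : Type w) [L.Structure C], InVariety E C → ∀ g : P →[L] C,
      g ∘ e = val zero C → g a = g b) :
    ∃ Δ : Set (Σ k, L.Functions k × (Fin k → P)), Δ.Finite ∧
      ∀ (C : Type w) [L.Structure C], InVariety E C → ∀ g : P → C, Respects Δ g →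
        g ∘ e = val zero C → g a = g b := by
  let θ := finitaryCongruence E zero e
  refine θ.mkHom_eq_iff.1 (h θ.Quot (hP.of_surjective θ.mkHom θ.mkHom_surjective) θ.mkHom ?_)
  rw [← map_val zero θ.mkHom]
  funext i
  refine θ.mkHom_eq_iff.2 ?_
  -- The instances met in evaluating the closed term `zero i` witness that `e i` is congruent to its
  -- value.
  obtain ⟨Δ, hfin, hΔ⟩ := exists_finite_respects_realize (zero i)
    (Empty.elim : Empty → P)
  refine ⟨Δ, hfin, fun C _ hC g hg he => (congrFun he i).trans ?_⟩
  exact (congrArg (fun x => (zero i).realize x) (Subsingleton.elim _ _)).trans (hΔ C g hg).symm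

/-! ### Existential formulas -/

theorem isExistential_exs {γ : Type*} : ∀ {m : ℕ} {φ : L.BoundedFormula γ m},
    φ.IsExistential → φ.exs.IsExistential
  | 0, _, h => h
  | _ + 1, φ, h => isExistential_exs (φ := φ.ex) (.ex h)

theorem isQF_iInf {γ β : Type*} [Finite β] {m : ℕ} {φ : β → L.BoundedFormula γ m}
    (h : ∀ b, (φ b).IsQF) : (BoundedFormula.iInf φ).IsQF := by
  simp only [BoundedFormula.iInf]
  generalize (Finset.toList _) = l
  induction l with
  | nil => exact BoundedFormula.IsQF.top
  | cons b l ih => exact (h b).inf ih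

/-- Solvability of a finite system of equations is expressed by an existential formula. -/
theorem exists_isExistential_realize_iff {γ β : Type*} [Finite β] {m : ℕ}
    (s t : β → L.Term (γ ⊕ Fin m)) :
    ∃ ρ : L.Formula γ, BoundedFormula.IsExistential ρ ∧
      ∀ (M : Type w) [L.Structure M] (z : γ → M), ρ.Realize z ↔
        ∃ y : Fin m → M, ∀ b,
          (s b).realize (Sum.elim z y) = (t b).realize (Sum.elim z y) := by
  refine ⟨(BoundedFormula.iInf fun b => (s b).bdEqual (t b)).exs,
    isExistential_exs (isQF_iInf fun b => (BoundedFormula.IsAtomic.equal _ _).isQF).isExistential,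
    fun M _ z => ?_⟩
  simp only [BoundedFormula.realize_exs, BoundedFormula.realize_iInf,
    BoundedFormula.realize_bdEqual]

/-- If all homomorphisms from `P` sending `e` to `0` identify `a` and `b`, then this fact is
witnessed by an existential formula. -/
theorem exists_isExistential_of_forall_hom [L.IsAlgebraic] {E : Set (L.Term ℕ × L.Term ℕ)} {n : ℕ}
    {zero : Fin n → L.Term Empty} {e : Fin n → P} {a b : P} (hP : InVariety E P)
    (h : ∀ (C : Type w) [L.Structure C], InVariety E C → ∀ g : P →[L] C,
      g ∘ e = val zero C → g a = g b) :
    ∃ ρ : L.Formula (Fin n ⊕ Fin 2), BoundedFormula.IsExistential ρ ∧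
      (∀ (Q : Type w) [L.Structure Q] (g : P →[L] Q),
        ρ.Realize (Sum.elim (g ∘ e) ![g a, g b])) ∧
      ∀ (Q C : Type w) [L.Structure Q] [L.Structure C], InVariety E C → ∀ (g : Q →[L] C)
        (z : Fin n → Q) (x y : Q), ρ.Realize (Sum.elim z ![x, y]) → g ∘ z = val zero C →
          g x = g y := by
  obtain ⟨Δ, hfin, hΔ⟩ := exists_finite_respects hP h
  let p : Fin n ⊕ Fin 2 → P := Sum.elim e ![a, b]
  have hS : (Set.range p ∪ ⋃ o ∈ Δ, insert (funMap o.2.1 o.2.2) (Set.range o.2.2)).Finite :=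
    (Set.finite_range p).union (hfin.biUnion fun o _ => (Set.finite_range _).insert _)
  obtain ⟨m, y, -, hy⟩ := hS.fin_param
  have hp (c) : ∃ j, y j = p c := by
    rw [← Set.mem_range, hy]
    exact Or.inl ⟨c, rfl⟩
  have harg (o : Δ) (i) : ∃ j, y j = o.1.2.2 i := by
    rw [← Set.mem_range, hy]
    exact Or.inr (Set.mem_biUnion o.2 (Or.inr ⟨i, rfl⟩))
  have hval (o : Δ) : ∃ j, y j = funMap o.1.2.1 o.1.2.2 := by
    rw [← Set.mem_range, hy]
    exact Or.inr (Set.mem_biUnion o.2 (Or.inl rfl))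
  have : Nonempty (Fin m) := ⟨(hp (Sum.inr 0)).choose⟩
  -- One bound variable per element of the finite set of parameters, arguments and values; outside
  -- that set `idx` is junk.
  let idx : P → Fin m := Function.invFun y
  have : Finite Δ := hfin
  obtain ⟨ρ, hρ, hρ'⟩ := exists_isExistential_realize_iff.{u, v, w} (L := L)
    (γ := Fin n ⊕ Fin 2) (β := (Fin n ⊕ Fin 2) ⊕ Δ) (m := m)
    (Sum.elim (fun c => Term.var (Sum.inl c))
      (fun o => Term.var (Sum.inr (idx (funMap o.1.2.1 o.1.2.2)))))
    (Sum.elim (fun c => Term.var (Sum.inr (idx (p c))))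
      (fun o => Term.func o.1.2.1 fun i => Term.var (Sum.inr (idx (o.1.2.2 i)))))
  refine ⟨ρ, hρ, fun Q _ g => (hρ' Q _).2 ⟨g ∘ y, ?_⟩, fun Q C _ _ hC g z c d hz hgz => ?_⟩
  · have key : Sum.elim (g ∘ e) ![g a, g b] = g ∘ p := by
      funext c
      rcases c with c | c
      · rfl
      · fin_cases c <;> rfl
    rw [key]
    rintro (c | o)
    · exact congrArg g (Function.invFun_eq (hp c)).symm
    · refine (congrArg g (Function.invFun_eq (hval o))).trans ((g.map_fun _ _).trans ?_)
      exact congrArg (funMap o.1.2.1)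
        (funext fun i => (congrArg g (Function.invFun_eq (harg o i))).symm)
  · obtain ⟨q, hq⟩ := (hρ' Q _).1 hz
    have hp' (i) : Sum.elim z ![c, d] i = q (idx (p i)) := hq (Sum.inl i)
    have hc : c = q (idx a) := hp' (Sum.inr 0)
    have hd : d = q (idx b) := hp' (Sum.inr 1)
    rw [hc, hd]
    -- This map need not be a homomorphism: the solved equations only make it respect `Δ`, which
    -- suffices.
    refine hΔ C hC (fun s => g (q (idx s))) (fun o ho => ?_) ?_
    · exact (congrArg g (hq (Sum.inr ⟨o, ho⟩))).trans (g.map_fun _ _)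
    · rw [← hgz]
      exact funext fun i => (congrArg g (hp' (Sum.inl i))).symm

end Compactness

/-! ### Complements -/

section Complements

variable {E : Set (L.Term ℕ × L.Term ℕ)} {n : ℕ} {zero one : Fin n → L.Term Empty}

/-- A homomorphism from `A × B` sending `[1, 0]` to `1` factors through the first projection. -/
theorem DefinesRight.apply_eq_of_apply_pair_eq_one [L.IsAlgebraic] {ρ : L.Formula (Fin n ⊕ Fin 2)}
    (hρ : BoundedFormula.IsExistential ρ) (hR : DefinesRight.{u, v, w} E zero one ρ)
    {A B C : Type w} [L.Structure A] [L.Structure B] [L.Structure C]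
    (hA : InVariety E A) (hB : InVariety E B) (hC : InVariety E C) (g : A × B →[L] C)
    (hg : g ∘ pair (val one A) (val zero B) = val one C) (a : A) (c d : B) :
    g (a, c) = g (a, d) := by
  -- The factors are swapped so that [1, 0] becomes [0, 1]. Keeping `B` and `A` makes (b, a) ↦ (b,
  -- (a, g(a, b))) injective, and `hg` makes it send [0, 1] to [0, 1].
  let j : B × A →[L] B × (A × C) :=
    prodHom (fstHom L B A)
      (prodHom (sndHom L B A) (g.comp (prodHom (sndHom L B A) (fstHom L B A))))
  have hj : Function.Injective j := fun x y h =>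
    Prod.ext (congrArg (fun t => t.1) h) (congrArg (fun t => t.2.1) h)
  have h := (hR B A hB hA c d a a).2 rfl
  have h' := hρ.realize_embedding (Embedding.ofInjective hj) h
  have hone : val one (A × C) = fun i => (val one A i, val one C i) := by
    funext i
    exact Prod.ext (congrFun (map_val one (fstHom L A C)) i)
      (congrFun (map_val one (sndHom L A C)) i)
  have key : (Embedding.ofInjective hj ∘
      Sum.elim (pair (val zero B) (val one A)) ![(c, a), (d, a)] : _ → B × (A × C)) =
      Sum.elim (pair (val zero B) (val one (A × C))) ![(c, a, g (a, c)), (d, a, g (a, d))] := by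
    funext i
    rcases i with i | i
    · rw [hone, ← hg]
      rfl
    · fin_cases i <;> rfl
  rw [key, Subsingleton.elim (_ ∘ _ : Fin 0 → _) default] at h'
  exact congrArg Prod.snd ((hR B (A × C) hB (hA.prod hC) c d _ _).1 h')

/-- In a variety stable by complements, a homomorphism sending `[0, 1]` to `0` sends
`[1, 0]` to `1`. -/
theorem IsStableByComplements.apply_pair_eq_one
    (hS : IsStableByComplements.{u, v, w} E zero one)
    {A B C : Type w} [L.Structure A] [L.Structure B] [L.Structure C]
    (hA : InVariety E A) (hB : InVariety E B) (hC : InVariety E C) (g : A × B →[L] C)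
    (hg : g ∘ pair (val zero A) (val one B) = val zero C) :
    g ∘ pair (val one A) (val zero B) = val one C := by
  obtain ⟨C₁, C₂, _, _, τ, h₁, h₂⟩ := (hS (A × B) C (hA.prod hB) hC g).2
    (pair (val zero A) (val one B)) (pair (val one A) (val zero B))
    ⟨A, B, inferInstance, inferInstance, FirstOrder.Language.Equiv.refl L (A × B), rfl, rfl⟩
  have hτ (c : Fin n → L.Term Empty) : τ ∘ val c C = pair (val c C₁) (val c C₂) := by
    refine (map_val c τ.toHom).trans (funext fun i => Prod.ext ?_ ?_)
    · exact congrFun (map_val c (fstHom L C₁ C₂)) i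
    · exact congrFun (map_val c (sndHom L C₁ C₂)) i
  -- Now `h₁` reads [0, 0] = [0, 1], so 0 = 1 in `C₂` and the complement [1, 0] equals [1, 1].
  rw [hg, hτ] at h₁
  have htriv : val zero C₂ = val one C₂ := funext fun i => congrArg Prod.snd (congrFun h₁ i)
  rw [htriv, ← hτ] at h₂
  exact τ.injective.comp_left h₂

/-- Right existential definability of factor congruences already forces `0 ≈ 1 → x ≈ y`, so that
this need not be assumed. -/
theorem HasRexDFC.hasLexDFC [L.IsAlgebraic]
    (hR : HasRexDFC.{u, v, max u w} E zero one)
    (hS : IsStableByComplements.{u, v, max u w} E zero one) :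
    HasLexDFC.{u, v, max u w} E zero one := by
  obtain ⟨hBFC, lam, hlam, hdef⟩ := hR
  refine ⟨hBFC, ?_⟩
  obtain ⟨F, _, ι, hF, hfree⟩ := exists_free.{u, v, w} E (Fin 2)
  obtain ⟨ρ, hρ, hhom, hsound⟩ := exists_isExistential_of_forall_hom
    (e := pair (val zero F) (val one F)) (a := (ι 0, ι 0)) (b := (ι 0, ι 1)) (hF.prod hF)
    fun C _ hC g hg => hdef.apply_eq_of_apply_pair_eq_one hlam hF hF hC g
      (hS.apply_pair_eq_one hF hF hC g hg) _ _ _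
  refine ⟨ρ, hρ, fun A B _ _ hA hB a b c d => ⟨fun h => ?_, ?_⟩⟩
  · exact hsound (A × B) A hA (fstHom L A B) _ _ _ h rfl
  · rintro rfl
    -- Both generators go to `a` in the first factor and to `c`, `d` in the second, carrying the
    -- generic pair to the given one.
    obtain ⟨g, hg⟩ := hfree A hA fun _ => a
    obtain ⟨k, hk⟩ := hfree B hB ![c, d]
    have h := hhom (A × B)
      (prodHom (g.comp (fstHom L F F)) (k.comp (sndHom L F F)))
    have key : (prodHom (g.comp (fstHom L F F)) (k.comp (sndHom L F F))) ∘
        pair (val zero F) (val one F) = pair (val zero A) (val one B) := by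
      rw [← map_val zero g, ← map_val one k]
      rfl
    have hx (i) : prodHom (g.comp (fstHom L F F)) (k.comp (sndHom L F F)) (ι 0, ι i) =
        (a, ![c, d] i) := Prod.ext (hg 0) (hk i)
    rw [key, hx, hx] at h
    exact h

end Complements

end UnivAlg

theorem mainTheorem4 (L : FirstOrder.Language.{u, v}) [L.IsAlgebraic]
    (E : Set (L.Term ℕ × L.Term ℕ)) (n : ℕ) (zero one : Fin n → L.Term Empty)
    (h01 : UnivAlg.IsWithZeroOne.{u, v, max u w} E zero one)
    (hR : UnivAlg.HasRexDFC.{u, v, max u w} E zero one)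
    (hS : UnivAlg.IsStableByComplements.{u, v, max u w} E zero one) :
    UnivAlg.HasLexDFC.{u, v, max u w} E zero one ∧
      UnivAlg.HasTexDFC.{u, v, max u w} E zero one :=
  have hL := hR.hasLexDFC hS
  ⟨hL, hR, hL⟩
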